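/- Let $\Gamma$ be a finite group, $\Gamma'\le\Gamma$ a subgroup, and $S$ a set of prime numbers. Let $\mathbb Z_S\subseteq\mathbb Q$ be the localization of $\mathbb Z$ at the nonzero integers not divisible by any prime in $S$, and write $\mathbb Z_{(p)}=\mathbb Z_{\{p\}}$. If $B$ is a finite-dimensional $\mathbb Q$-algebra, a $\mathbb Z_S$-order in $B$ is a subring of $B$ with the same identity that is finitely generated as a $\mathbb Z_S$-module and spans $B$ over $\mathbb Q$; it is maximal if it is not properly contained in another $\mathbb Z_S$-order of $B$. (If $e$ is an idempotent of a ring $A$, then $eAe$ is regarded as a ring with identity $e$.) Let $e_1'=\frac1{|\Gamma'|}\sum_{\tau\in\Gamma'}\tau\in\mathbb Q[\Gamma]$, and let $e_{\Gamma/\Gamma'}$ be the central idempotent of $\mathbb Q[\Gamma]$ associated to the augmentation character $a_{\Gamma/\Gamma'}=\mathrm{Ind}_{\Gamma'}^{\Gamma}1-1$, i.e. the minimal central idempotent that acts as the identity on a $\mathbb Q$-representation with character $a_{\Gamma/\Gamma'}$. Assume that every $p\in S$ is good for $e_{\Gamma/\Gamma'}$, i.e. $e_{\Gamma/\Gamma'}\in\mathbb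 Z_{(p)}[\Gamma]$ and $e_{\Gamma/\Gamma'}\mathbb Z_{(p)}[\Gamma]$ is a maximal $\mathbb Z_{(p)}$-order in $e_{\Gamma/\Gamma'}\mathbb Q[\Gamma]$. Let $\mathcal O\subseteq\mathbb Q[\Gamma]$ be a maximal $\mathbb Z_S$-order containing $\mathbb Z_S[\Gamma]$, and let $$\mathfrak o={}^{\Gamma'}\big(e_{\Gamma/\Gamma'}\mathcal O e_1'\big)=\{x\in e_{\Gamma/\Gamma'}\mathcal O e_1' : \tau x=x\ \text{for all}\ \tau\in\Gamma'\}.$$ Then $\mathfrak o$ is a maximal $\mathbb Z_S$-order in the $\mathbb Q$-algebra $e_1'e_{\Gamma/\Gamma'}\mathbb Q[\Gamma]e_1'$. -/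

import Mathlib

open scoped MonoidAlgebra

noncomputable section

namespace HeckeOrder

/-- The ring `ℤ_S ⊆ ℚ` for a set `S` of primes: the fractions whose (reduced) denominator is not
divisible by any prime in `S`, i.e. the localization of `ℤ` at the nonzero integers that are not
divisible by any prime in `S`. -/
def ZS (S : Set Nat.Primes) : Subring ℚ where
  carrier := {q | ∀ p ∈ S, ¬ (p : ℕ) ∣ q.den}
  mul_mem' {a b} ha hb p hp h :=
    (p.2.dvd_mul.1 (h.trans (Rat.mul_den_dvd a b))).elim (ha p hp) (hb p hp)
  one_mem' p _ := by simpa using p.2.one_lt.ne'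
  add_mem' {a b} ha hb p hp h :=
    (p.2.dvd_mul.1 (h.trans (Rat.add_den_dvd a b))).elim (ha p hp) (hb p hp)
  zero_mem' p _ := by simpa using p.2.one_lt.ne'
  neg_mem' {a} ha p hp := by simpa using ha p hp

section Orders

variable {A : Type*} [Ring A] [Algebra ℚ A]

/-- The `ℚ`-algebra `f A f`. For an idempotent `f` this is an algebra with identity `f`; for
a central idempotent `f` it is `f A`, and for `f = 1` it is `A`. -/
def corner (f : A) : Submodule ℚ A :=
  LinearMap.range (LinearMap.mulLeft ℚ f ∘ₗ LinearMap.mulRight ℚ f)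

/-- `Λ` is an `R`-order in the `ℚ`-algebra `f A f` (`f` an idempotent): a subring of `f A f` with
the same identity `f`, which is a finitely generated `R`-module and spans `f A f` over `ℚ`. -/
structure IsOrder (R : Subring ℚ) (f : A) (Λ : Submodule R A) : Prop where
  le_corner : ∀ x ∈ Λ, x ∈ corner f
  one_mem : f ∈ Λ
  mul_mem : ∀ x ∈ Λ, ∀ y ∈ Λ, x * y ∈ Λ
  fg : Λ.FG
  span_eq : Submodule.span ℚ (Λ : Set A) = corner f

/-- `Λ` is a maximal `R`-order in the `ℚ`-algebra `f A f`: an order that is not properly contained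
in another order. -/
structure IsMaximalOrder (R : Subring ℚ) (f : A) (Λ : Submodule R A) : Prop where
  isOrder : IsOrder R f Λ
  maximal : ∀ Λ' : Submodule R A, IsOrder R f Λ' → Λ ≤ Λ' → Λ' = Λ

end Orders

section Idempotents

variable {Γ : Type*} [Group Γ]

/-- `e` is the minimal central idempotent of `ℚ[Γ]` that acts as the identity on the
representation `ρ`. For idempotents, `e ≤ f` means `e * f = e`. -/
structure IsAssociatedIdempotent {V : Type*} [AddCommGroup V] [Module ℚ V]
    (ρ : Representation ℚ Γ V) (e : ℚ[Γ]) : Prop where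
  central : ∀ x : ℚ[Γ], e * x = x * e
  idem : e * e = e
  acts : ρ.asAlgebraHom e = 1
  minimal : ∀ f : ℚ[Γ], (∀ x : ℚ[Γ], f * x = x * f) → f * f = f →
    ρ.asAlgebraHom f = 1 → e * f = e

theorem exists_isAssociatedIdempotent [Finite Γ] {V : Type*} [AddCommGroup V] [Module ℚ V]
    (ρ : Representation ℚ Γ V) : ∃ e, IsAssociatedIdempotent ρ e := by
  have hne : {N : Submodule ℚ ℚ[Γ] | ∃ f : ℚ[Γ], (∀ x : ℚ[Γ], f * x = x * f) ∧ f * f = f ∧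
      ρ.asAlgebraHom f = 1 ∧ N = LinearMap.range (LinearMap.mulLeft ℚ f)}.Nonempty :=
    ⟨_, 1, by simp, by simp, by simp, rfl⟩
  obtain ⟨N, ⟨e, hc, hi, ha, rfl⟩, hmin⟩ := IsArtinian.set_has_minimal _ hne
  refine ⟨e, hc, hi, ha, fun f fc fi fa => ?_⟩
  have hle : LinearMap.range (LinearMap.mulLeft ℚ (e * f)) ≤
      LinearMap.range (LinearMap.mulLeft ℚ e) := by
    rintro _ ⟨x, rfl⟩
    exact ⟨f * x, by simp⟩
  have hnlt := hmin _ ⟨e * f, fun x => by rw [mul_assoc, fc, ← mul_assoc, hc, mul_assoc],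
    by rw [mul_assoc, ← mul_assoc f, fc e, mul_assoc, fi, ← mul_assoc, hi],
    by rw [map_mul, ha, fa, one_mul], rfl⟩
  have heq := eq_of_le_of_not_lt hle hnlt
  obtain ⟨y, hy⟩ : e ∈ LinearMap.range (LinearMap.mulLeft ℚ (e * f)) := by
    rw [heq]; exact ⟨1, by simp⟩
  simp only [LinearMap.mulLeft_apply] at hy
  rw [← fc, ← hy, ← mul_assoc, ← mul_assoc f e f, fc e, mul_assoc e f f, fi]

/-- The augmentation representation of `Γ` on the elements of `ℚ[Γ/Γ']` with coefficient sum `0`.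
Since `ℚ[Γ/Γ']` is the sum of this representation and the trivial one, its character is
`Ind_{Γ'}^Γ 1 - 1`. -/
def augmentationSub [Finite Γ] (Γ' : Subgroup Γ) :
    Subrepresentation (Representation.ofMulAction ℚ Γ (Γ ⧸ Γ')) where
  toSubmodule := LinearMap.ker
    (Finsupp.linearCombination ℚ (fun _ : Γ ⧸ Γ' => (1 : ℚ)) ∘ₗ
      (MonoidAlgebra.coeffLinearEquiv (S := ℚ) (M := Γ ⧸ Γ') ℚ).toLinearMap)
  apply_mem_toSubmodule g v hv := by
    rw [LinearMap.mem_ker] at hv ⊢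
    rw [← hv]
    simp [Representation.ofMulAction_def, Finsupp.linearCombination_mapDomain, Function.comp_def]

/-- The representation of `Γ` on the augmentation subspace of `ℚ[Γ/Γ']`. -/
def augmentationRep [Finite Γ] (Γ' : Subgroup Γ) :
    Representation ℚ Γ (augmentationSub Γ').toSubmodule :=
  (augmentationSub Γ').toRepresentation

/-- The central idempotent `e_{Γ/Γ'}` of `ℚ[Γ]` associated to the augmentation character
`Ind_{Γ'}^Γ 1 - 1`. -/
def augIdem [Finite Γ] (Γ' : Subgroup Γ) : ℚ[Γ] :=
  (exists_isAssociatedIdempotent (augmentationRep Γ')).choose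

theorem augIdem_spec [Finite Γ] (Γ' : Subgroup Γ) :
    IsAssociatedIdempotent (augmentationRep Γ') (augIdem Γ') :=
  (exists_isAssociatedIdempotent (augmentationRep Γ')).choose_spec

/-- The idempotent `e₁' = |Γ'|⁻¹ ∑_{τ ∈ Γ'} τ` of `ℚ[Γ]`. -/
def unitIdem (Γ' : Subgroup Γ) : ℚ[Γ] :=
  (Nat.card Γ' : ℚ)⁻¹ • ∑ᶠ τ : Γ', MonoidAlgebra.of ℚ Γ (τ : Γ)

/-- The algebra `f ℚ[Γ] f` with `f = e₁' e_{Γ/Γ'}` is `e₁' e_{Γ/Γ'} ℚ[Γ] e₁'`. -/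
theorem mem_corner_iff [Finite Γ] (Γ' : Subgroup Γ) (y : ℚ[Γ]) :
    y ∈ corner (unitIdem Γ' * augIdem Γ') ↔
      ∃ x : ℚ[Γ], unitIdem Γ' * augIdem Γ' * x * unitIdem Γ' = y := by
  have h := augIdem_spec Γ'
  have key : ∀ x : ℚ[Γ], unitIdem Γ' * augIdem Γ' * (x * (unitIdem Γ' * augIdem Γ')) =
      unitIdem Γ' * augIdem Γ' * x * unitIdem Γ' := fun x => by
    rw [← h.central (unitIdem Γ'), ← mul_assoc x, ← h.central x, mul_assoc (augIdem Γ') x,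
      h.central (unitIdem Γ'), mul_assoc (unitIdem Γ'), ← mul_assoc (augIdem Γ'), h.idem]
    simp only [mul_assoc]
  simp only [corner, LinearMap.mem_range, LinearMap.comp_apply, LinearMap.mulLeft_apply,
    LinearMap.mulRight_apply, key]

end Idempotents

section Lattices

variable {Γ : Type*} [Group Γ]

/-- The group ring `ℤ_S[Γ]` inside `ℚ[Γ]`. -/
def groupRing (S : Set Nat.Primes) (Γ : Type*) [Group Γ] : Submodule (ZS S) ℚ[Γ] where
  carrier := {x | ∀ g, x.coeff g ∈ ZS S}
  add_mem' {x y} hx hy g := by simpa using add_mem (hx g) (hy g)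
  zero_mem' g := by simp [zero_mem]
  smul_mem' c x hx g := by simpa [Subring.smul_def] using mul_mem c.2 (hx g)

/-- The prime `p` is good for the central idempotent `e` of `ℚ[Γ]`: `e ∈ ℤ_(p)[Γ]` and `e ℤ_(p)[Γ]`
is a maximal `ℤ_(p)`-order in `e ℚ[Γ]`. -/
def IsGoodPrime (p : Nat.Primes) (e : ℚ[Γ]) : Prop :=
  e ∈ groupRing {p} Γ ∧
    IsMaximalOrder (ZS {p}) e ((groupRing {p} Γ).map (LinearMap.mulLeft (ZS {p}) e))

/-- The elements of `M ⊆ ℚ[Γ]` that are fixed by left multiplication by the elements of `Γ'`. -/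
def leftInvariants {R : Subring ℚ} (Γ' : Subgroup Γ) (M : Submodule R ℚ[Γ]) :
    Submodule R ℚ[Γ] where
  carrier := {x | x ∈ M ∧ ∀ τ ∈ Γ', MonoidAlgebra.of ℚ Γ τ * x = x}
  add_mem' {x y} hx hy := ⟨add_mem hx.1 hy.1, fun τ hτ => by rw [mul_add, hx.2 τ hτ, hy.2 τ hτ]⟩
  zero_mem' := ⟨zero_mem _, fun τ _ => mul_zero _⟩
  smul_mem' c x hx := ⟨M.smul_mem c hx.1, fun τ hτ => by rw [mul_smul_comm, hx.2 τ hτ]⟩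

/-- The order `𝔬 = ^{Γ'}(e_{Γ/Γ'} 𝒪 e₁')`. -/
def heckeOrder [Finite Γ] {R : Subring ℚ} (Γ' : Subgroup Γ) (O : Submodule R ℚ[Γ]) :
    Submodule R ℚ[Γ] :=
  leftInvariants Γ'
    (O.map (LinearMap.mulLeft R (augIdem Γ') ∘ₗ LinearMap.mulRight R (unitIdem Γ')))

end Lattices

end HeckeOrder

end

/-!
Write `P` for the left lattice `e ℤ_S[Γ] e₁'`. Since `e ℤ_S[Γ]` is a maximal order at each prime
of `S`, it is a maximal `ℤ_S`-order, so it equals `e 𝒪`, and `𝔬` is the ring of endomorphisms of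
`P`, acting from the right. A right `Γ'`-invariant element of `ℤ_S[Γ]` is a left multiple of
`|Γ'| e₁' = ∑_{τ ∈ Γ'} τ`; hence `P` is reflexive over `Λ = e ℤ_S[Γ]`, i.e. `P** = P` for the dual
`P* = Hom_Λ(P, Λ)`. If an order `Λ'` contains `𝔬`, then `P* P ⊆ 𝔬 ⊆ Λ'` makes `Λ + P Λ' P*` an
order, so it is `Λ` by maximality. Thus `P Λ' P* ⊆ Λ`, which says that `P Λ' ⊆ P** = P`, and
therefore `Λ' = 𝔬`.
-/

namespace HeckeOrder

instance isNoetherianRing_subring_rat (R : Subring ℚ) : IsNoetherianRing R := by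
  have hden (q : R) : IsUnit (algebraMap ℤ R (q : ℚ).den) := by
    obtain ⟨a, b, hab⟩ := Rat.isCoprime_num_den (q : ℚ)
    have hinv : ((q : ℚ).den : ℚ)⁻¹ = a * q + b := by
      have hd : ((q : ℚ).den : ℚ) ≠ 0 := mod_cast (q : ℚ).den_ne_zero
      have hab' : (a * (q : ℚ).num + b * (q : ℚ).den : ℚ) = 1 := mod_cast hab
      rw [← Rat.mul_den_eq_num] at hab'
      field_simp
      linear_combination -hab'
    have hmem : ((q : ℚ).den : ℚ)⁻¹ ∈ R :=
      hinv ▸ add_mem (mul_mem (intCast_mem R a) q.2) (intCast_mem R b)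
    exact .of_mul_eq_one ⟨_, hmem⟩ (Subtype.ext (by simp))
  have : IsLocalization ((IsUnit.submonoid R).comap (algebraMap ℤ R)) R :=
    ⟨fun y => y.2, fun q => ⟨((q : ℚ).num, ⟨_, hden q⟩), Subtype.ext (by simp)⟩,
      fun h => ⟨1, by simp_all⟩⟩
  exact IsLocalization.isNoetherianRing ((IsUnit.submonoid R).comap (algebraMap ℤ R)) R
    inferInstance

theorem ZS_anti {S T : Set Nat.Primes} (h : T ⊆ S) : ZS S ≤ ZS T :=
  fun _ hq p hp => hq p (h hp)

section Denominators

variable {V : Type*} [AddCommGroup V] [Module ℚ V] {R : Subring ℚ} {M N : Submodule R V}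

theorem exists_natCast_smul_mem {x : V} (hx : x ∈ Submodule.span ℚ (M : Set V)) :
    ∃ n : ℕ, n ≠ 0 ∧ (n : ℚ) • x ∈ M := by
  induction hx using Submodule.span_induction with
  | mem x hx => exact ⟨1, one_ne_zero, by simpa using hx⟩
  | zero => exact ⟨1, one_ne_zero, by simp⟩
  | add x y _ _ hx hy =>
    obtain ⟨m, hm, hmx⟩ := hx
    obtain ⟨n, hn, hny⟩ := hy
    refine ⟨n * m, mul_ne_zero hn hm, ?_⟩
    have hsum : ((n * m : ℕ) : ℚ) • (x + y) = n • ((m : ℚ) • x) + m • ((n : ℚ) • y) := by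
      simp only [← Nat.cast_smul_eq_nsmul ℚ, smul_smul, smul_add, Nat.cast_mul, mul_comm]
    exact hsum ▸ add_mem (nsmul_mem hmx n) (nsmul_mem hny m)
  | smul c x _ hx =>
    obtain ⟨n, hn, hnx⟩ := hx
    refine ⟨c.den * n, mul_ne_zero c.den_ne_zero hn, ?_⟩
    have hmul : ((c.den * n : ℕ) : ℚ) • c • x = c.num • ((n : ℚ) • x) := by
      rw [← Int.cast_smul_eq_zsmul ℚ, smul_smul, smul_smul, Nat.cast_mul, ← Rat.mul_den_eq_num]
      congr 1
      ring
    exact hmul ▸ zsmul_mem hnx c.num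

theorem exists_forall_natCast_smul_mem (hN : N.FG)
    (hNM : ∀ x ∈ N, x ∈ Submodule.span ℚ (M : Set V)) :
    ∃ n : ℕ, n ≠ 0 ∧ ∀ x ∈ N, (n : ℚ) • x ∈ M := by
  classical
  obtain ⟨T, rfl⟩ := hN
  choose! n hn hnM using fun x (hx : x ∈ T) =>
    exists_natCast_smul_mem (hNM x (Submodule.subset_span hx))
  refine ⟨∏ t ∈ T, n t, Finset.prod_ne_zero_iff.2 hn, fun x hx => ?_⟩
  induction hx using Submodule.span_induction with
  | mem x hx =>
    rw [← Finset.prod_erase_mul _ _ hx, Nat.cast_mul, mul_smul, Nat.cast_smul_eq_nsmul]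
    exact nsmul_mem (hnM x hx) _
  | zero => simp
  | add x y _ _ hx hy => exact smul_add (_ : ℚ) x y ▸ add_mem hx hy
  | smul c x _ hx => exact smul_comm (_ : ℚ) c x ▸ M.smul_mem c hx

theorem fg_of_forall_natCast_smul_mem (hM : M.FG) {n : ℕ} (hn : n ≠ 0)
    (h : ∀ x ∈ N, (n : ℚ) • x ∈ M) : N.FG := by
  have hinj : Function.Injective (LinearMap.lsmul ℚ V (n : ℚ) |>.restrictScalars R) :=
    smul_right_injective V (Nat.cast_ne_zero.2 hn)
  have := isNoetherian_of_fg_of_noetherian M hM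
  exact Submodule.fg_of_fg_map_injective _ hinj
    (.of_le_of_isNoetherian (Submodule.map_le_iff_le_comap.2 h))

end Denominators

section Orders

variable {A : Type*} [Ring A] [Algebra ℚ A] {R : Subring ℚ} {e f u x : A}

/-- The Peirce component `e A f` of `A`, so that `corner f` is `peirce f f`. -/
def peirce (e f : A) : Submodule ℚ A :=
  LinearMap.range (LinearMap.mulLeft ℚ e ∘ₗ LinearMap.mulRight ℚ f)

theorem mem_peirce_iff (he : IsIdempotentElem e) (hf : IsIdempotentElem f) :
    x ∈ peirce e f ↔ e * x = x ∧ x * f = x := by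
  constructor
  · rintro ⟨y, rfl⟩
    simp [he.mul_self_mul, mul_assoc, hf.eq]
  · rintro ⟨hex, hxf⟩
    exact ⟨x, by simp [hxf, hex]⟩

theorem mem_corner_iff_of_isIdempotentElem (hf : IsIdempotentElem f) :
    x ∈ corner f ↔ f * x = x ∧ x * f = x :=
  mem_peirce_iff hf hf

theorem corner_one : corner (1 : A) = ⊤ :=
  eq_top_iff.2 fun x _ => ⟨x, by simp⟩

variable {Λ Λ' P M : Submodule R A}

theorem sup_mul_mul_mul_le (hΛ : Λ * Λ ≤ Λ) (hΛ' : Λ' * Λ' ≤ Λ') (hΛP : Λ * P ≤ P)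
    (hMΛ : M * Λ ≤ M) (hMP : M * P ≤ Λ') :
    (Λ ⊔ P * Λ' * M) * (Λ ⊔ P * Λ' * M) ≤ Λ ⊔ P * Λ' * M := by
  have hleft : Λ * (P * Λ' * M) ≤ P * Λ' * M := by
    simp only [← mul_assoc]
    gcongr
  have hright : P * Λ' * M * Λ ≤ P * Λ' * M := by
    rw [mul_assoc _ M]
    gcongr
  have hmid : P * Λ' * M * (P * Λ' * M) ≤ P * Λ' * M :=
    calc P * Λ' * M * (P * Λ' * M) = P * (Λ' * (M * P) * Λ') * M := by simp only [mul_assoc]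
      _ ≤ P * (Λ' * Λ' * Λ') * M := by gcongr
      _ ≤ P * (Λ' * Λ') * M := by gcongr
      _ ≤ P * Λ' * M := by gcongr
  rw [Submodule.sup_mul, Submodule.mul_sup, Submodule.mul_sup]
  exact sup_le (sup_le (hΛ.trans le_sup_left) (hleft.trans le_sup_right))
    (sup_le (hright.trans le_sup_right) (hmid.trans le_sup_right))

namespace IsOrder

theorem mul_le (hΛ : IsOrder R f Λ) : Λ * Λ ≤ Λ :=
  Submodule.mul_le.2 hΛ.mul_mem

theorem span {R' : Subring ℚ} (hR : R ≤ R') (hΛ : IsOrder R f Λ) :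
    IsOrder R' f (Submodule.span R' (Λ : Set A)) where
  le_corner :=
    (Submodule.span_le (p := (corner f).restrictScalars R')).2 hΛ.le_corner
  one_mem := Submodule.subset_span hΛ.one_mem
  mul_mem x hx y hy := by
    have hxy := Submodule.mul_mem_mul hx hy
    rw [Submodule.span_mul_span] at hxy
    exact Submodule.span_mono (Set.mul_subset_iff.2 hΛ.mul_mem) hxy
  fg := by
    obtain ⟨T, rfl⟩ := hΛ.fg
    refine ⟨T, le_antisymm (Submodule.span_mono Submodule.subset_span)
      (Submodule.span_le.2 fun x hx => ?_)⟩
    induction hx using Submodule.span_induction with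
    | mem x hx => exact Submodule.subset_span hx
    | zero => exact zero_mem _
    | add x y _ _ hx hy => exact add_mem hx hy
    | smul c x _ hx => exact Submodule.smul_mem _ (⟨c, hR c.2⟩ : R') hx
  span_eq := by rw [Submodule.span_span_of_tower, hΛ.span_eq]

theorem map_mulLeft (hΛ : IsOrder R 1 Λ) (hc : ∀ x, e * x = x * e) (he : IsIdempotentElem e)
    (heΛ : e ∈ Λ) : IsOrder R e (Λ.map (LinearMap.mulLeft R e)) where
  le_corner := by
    rintro _ ⟨x, -, rfl⟩
    exact ⟨x, by simp [← hc, he.mul_self_mul]⟩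
  one_mem := ⟨e, heΛ, he⟩
  mul_mem := by
    rintro _ ⟨x, hx, rfl⟩ _ ⟨y, hy, rfl⟩
    exact ⟨x * (e * y), hΛ.mul_mem x hx _ (hΛ.mul_mem e heΛ y hy), by simp [mul_assoc]⟩
  fg := hΛ.fg.map _
  span_eq := by
    have hcorner : corner e = LinearMap.range (LinearMap.mulLeft ℚ e) := by
      unfold corner
      congr 1
      ext x
      simp [← hc, he.mul_self_mul]
    rw [Submodule.map_coe, hcorner, ← Submodule.map_top, ← corner_one, ← hΛ.span_eq,
      Submodule.map_span]
    rfl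

theorem sup_mul_mul (he : IsIdempotentElem e) (hΛ : IsOrder R e Λ) (hΛ' : Λ' * Λ' ≤ Λ')
    (hfg : Λ'.FG) (hP : P.FG) (hM : M.FG) (heP : ∀ y ∈ P, e * y = y) (hMe : ∀ m ∈ M, m * e = m)
    (hΛP : Λ * P ≤ P) (hMΛ : M * Λ ≤ M) (hMP : M * P ≤ Λ') :
    IsOrder R e (Λ ⊔ P * Λ' * M) := by
  have hcorner : Λ ⊔ P * Λ' * M ≤ (corner e).restrictScalars R := by
    refine sup_le hΛ.le_corner (Submodule.mul_le.2 fun z hz m hm => ?_)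
    have hez : e * z = z := by
      have hle : P * Λ' ≤ LinearMap.eqLocus (LinearMap.mulLeft R e) LinearMap.id :=
        Submodule.mul_le.2 fun y hy x _ => by simp [← mul_assoc, heP y hy]
      exact hle hz
    exact (mem_corner_iff_of_isIdempotentElem he).2
      ⟨by rw [← mul_assoc, hez], by rw [mul_assoc, hMe m hm]⟩
  exact
    { le_corner := hcorner
      one_mem := Submodule.mem_sup_left hΛ.one_mem
      mul_mem := Submodule.mul_le.1
        (sup_mul_mul_mul_le hΛ.mul_le hΛ' hΛP hMΛ hMP)
      fg := hΛ.fg.sup ((hP.mul hfg).mul hM)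
      span_eq := le_antisymm (Submodule.span_le.2 hcorner)
        (hΛ.span_eq.symm.le.trans (Submodule.span_mono (le_sup_left (a := Λ)))) }

end IsOrder

/-- The right order `{x ∈ f A f | P x ⊆ P}` of `P ⊆ A f`. For a left module `P` over an order `Λ`
it stands for `End_Λ(P)`, acting from the right. -/
def rightOrder (f : A) (P : Submodule R A) : Submodule R A where
  carrier := {x | x ∈ corner f ∧ ∀ y ∈ P, y * x ∈ P}
  add_mem' hx hx' :=
    ⟨add_mem hx.1 hx'.1, fun y hy => by rw [mul_add]; exact add_mem (hx.2 y hy) (hx'.2 y hy)⟩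
  zero_mem' := ⟨zero_mem _, fun y _ => by simp⟩
  smul_mem' c _ hx := ⟨(corner f).smul_mem (c : ℚ) hx.1, fun y hy => by
    rw [mul_smul_comm]; exact P.smul_mem c (hx.2 y hy)⟩

/-- The dual `{m ∈ f A | P m ⊆ Λ}` of a left `Λ`-module `P ⊆ A f`, standing for `Hom_Λ(P, Λ)`. -/
def rightDual (f : A) (Λ P : Submodule R A) : Submodule R A where
  carrier := {m | f * m = m ∧ ∀ y ∈ P, y * m ∈ Λ}
  add_mem' hm hm' := ⟨by rw [mul_add, hm.1, hm'.1],
    fun y hy => by rw [mul_add]; exact add_mem (hm.2 y hy) (hm'.2 y hy)⟩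
  zero_mem' := ⟨mul_zero f, fun y _ => by simp⟩
  smul_mem' c _ hm := ⟨by rw [mul_smul_comm, hm.1],
    fun y hy => by rw [mul_smul_comm]; exact Λ.smul_mem c (hm.2 y hy)⟩

/-- The dual `{x ∈ A f | x M ⊆ Λ}` of a right `Λ`-module `M ⊆ f A`, standing for `Hom_Λ(M, Λ)`. -/
def leftDual (f : A) (Λ M : Submodule R A) : Submodule R A where
  carrier := {x | x * f = x ∧ ∀ m ∈ M, x * m ∈ Λ}
  add_mem' hx hx' := ⟨by rw [add_mul, hx.1, hx'.1],
    fun m hm => by rw [add_mul]; exact add_mem (hx.2 m hm) (hx'.2 m hm)⟩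
  zero_mem' := ⟨zero_mul f, fun m _ => by simp⟩
  smul_mem' c _ hx := ⟨by rw [smul_mul_assoc, hx.1],
    fun m hm => by rw [smul_mul_assoc]; exact Λ.smul_mem c (hx.2 m hm)⟩

theorem isOrder_rightOrder (he : IsIdempotentElem e) (hf : IsIdempotentElem f) (hef : e * f = f)
    (hfg : P.FG) (hspan : Submodule.span ℚ (P : Set A) = peirce e f) :
    IsOrder R f (rightOrder f P) where
  le_corner _ hx := hx.1
  one_mem := by
    refine ⟨(mem_corner_iff_of_isIdempotentElem hf).2 ⟨hf, hf⟩, fun y hy => ?_⟩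
    have hyf := ((mem_peirce_iff he hf).1 (hspan ▸ Submodule.subset_span hy)).2
    rwa [hyf]
  mul_mem x hx y hy := by
    have hfx := ((mem_corner_iff_of_isIdempotentElem hf).1 hx.1).1
    have hyf := ((mem_corner_iff_of_isIdempotentElem hf).1 hy.1).2
    refine ⟨(mem_corner_iff_of_isIdempotentElem hf).2
      ⟨by rw [← mul_assoc, hfx], by rw [mul_assoc, hyf]⟩, fun z hz => ?_⟩
    rw [← mul_assoc]
    exact hy.2 _ (hx.2 z hz)
  fg := by
    obtain ⟨n, hn, hnf⟩ := exists_natCast_smul_mem (M := P) (x := f)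
      (hspan ▸ (mem_peirce_iff he hf).2 ⟨hef, hf⟩)
    refine fg_of_forall_natCast_smul_mem hfg hn fun x hx => ?_
    have hfx := ((mem_corner_iff_of_isIdempotentElem hf).1 hx.1).1
    rw [← hfx, ← smul_mul_assoc]
    exact hx.2 _ hnf
  span_eq := by
    refine le_antisymm (Submodule.span_le.2 fun _ hx => hx.1) fun x hx => ?_
    have hxf := ((mem_corner_iff_of_isIdempotentElem hf).1 hx).2
    obtain ⟨n, hn, hnP⟩ := exists_forall_natCast_smul_mem (M := P)
      (N := P.map (LinearMap.mulRight R x)) (hfg.map _) (by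
        rintro _ ⟨y, hy, rfl⟩
        have hey := ((mem_peirce_iff he hf).1 (hspan ▸ Submodule.subset_span hy)).1
        rw [hspan, mem_peirce_iff he hf]
        simp [mul_assoc, hxf, ← mul_assoc e, hey])
    refine (Submodule.smul_mem_iff _ (Nat.cast_ne_zero.2 hn : (n : ℚ) ≠ 0)).1
      (Submodule.subset_span ⟨(corner f).smul_mem _ hx, fun y hy => ?_⟩)
    rw [mul_smul_comm]
    exact hnP _ ⟨y, hy, rfl⟩

theorem mul_leftDual_le (hΛ : Λ * Λ ≤ Λ) : Λ * leftDual f Λ M ≤ leftDual f Λ M :=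
  Submodule.mul_le.2 fun a ha x hx => ⟨by rw [mul_assoc, hx.1], fun m hm => by
    rw [mul_assoc]; exact hΛ (Submodule.mul_mem_mul ha (hx.2 m hm))⟩

theorem rightDual_mul_le (hΛ : Λ * Λ ≤ Λ) : rightDual f Λ P * Λ ≤ rightDual f Λ P :=
  Submodule.mul_le.2 fun m hm a ha => ⟨by rw [← mul_assoc, hm.1], fun y hy => by
    rw [← mul_assoc]; exact hΛ (Submodule.mul_mem_mul (hm.2 y hy) ha)⟩

theorem rightDual_mul_le_rightOrder (hf : IsIdempotentElem f) (hPf : ∀ y ∈ P, y * f = y)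
    (hΛP : Λ * P ≤ P) : rightDual f Λ P * P ≤ rightOrder f P :=
  Submodule.mul_le.2 fun m hm y hy =>
    ⟨(mem_corner_iff_of_isIdempotentElem hf).2
      ⟨by rw [← mul_assoc, hm.1], by rw [mul_assoc, hPf y hy]⟩,
      fun z hz => by rw [← mul_assoc]; exact hΛP (Submodule.mul_mem_mul (hm.2 z hz) hy)⟩

theorem exists_forall_mem_rightDual_natCast_smul_mem (hf : f ∈ Submodule.span ℚ (P : Set A)) :
    ∃ n : ℕ, n ≠ 0 ∧ ∀ m ∈ rightDual f Λ P, (n : ℚ) • m ∈ Λ := by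
  obtain ⟨n, hn, hnf⟩ := exists_natCast_smul_mem hf
  refine ⟨n, hn, fun m hm => ?_⟩
  rw [← hm.1, ← smul_mul_assoc]
  exact hm.2 _ hnf

theorem rightDual_fg (hf : f ∈ Submodule.span ℚ (P : Set A)) (hΛ : Λ.FG) :
    (rightDual f Λ P).FG := by
  obtain ⟨n, hn, hnM⟩ := exists_forall_mem_rightDual_natCast_smul_mem (Λ := Λ) hf
  exact fg_of_forall_natCast_smul_mem hΛ hn hnM

theorem rightDual_le_span (hf : f ∈ Submodule.span ℚ (P : Set A)) :
    (rightDual f Λ P : Set A) ⊆ Submodule.span ℚ (Λ : Set A) := by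
  obtain ⟨n, hn, hnM⟩ := exists_forall_mem_rightDual_natCast_smul_mem (Λ := Λ) hf
  exact fun m hm => (Submodule.smul_mem_iff _ (Nat.cast_ne_zero.2 hn : (n : ℚ) ≠ 0)).1
    (Submodule.subset_span (hnM m hm))

theorem isMaximalOrder_rightOrder (hΛ : IsMaximalOrder R e Λ) (he : IsIdempotentElem e)
    (hf : IsIdempotentElem f) (hef : e * f = f) (hfg : P.FG)
    (hspan : Submodule.span ℚ (P : Set A) = peirce e f)
    (hrefl : leftDual f Λ (rightDual f Λ P) = P) :
    IsMaximalOrder R f (rightOrder f P) := by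
  refine ⟨isOrder_rightOrder he hf hef hfg hspan, fun Λ' hΛ' hle => le_antisymm ?_ hle⟩
  have hfP : f ∈ Submodule.span ℚ (P : Set A) := hspan ▸ (mem_peirce_iff he hf).2 ⟨hef, hf⟩
  have hP (y : A) (hy : y ∈ P) : e * y = y ∧ y * f = y :=
    (mem_peirce_iff he hf).1 (hspan ▸ Submodule.subset_span hy)
  have hMe (m : A) (hm : m ∈ rightDual f Λ P) : m * e = m :=
    ((mem_corner_iff_of_isIdempotentElem he).1 (hΛ.isOrder.span_eq ▸ rightDual_le_span hfP hm)).2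
  have hΛP : Λ * P ≤ P := hrefl ▸ mul_leftDual_le hΛ.isOrder.mul_le
  have hMP : rightDual f Λ P * P ≤ Λ' :=
    (rightDual_mul_le_rightOrder hf (fun y hy => (hP y hy).2) hΛP).trans hle
  have hsup : Λ ⊔ P * Λ' * rightDual f Λ P = Λ := hΛ.maximal _
    (hΛ.isOrder.sup_mul_mul he hΛ'.mul_le hΛ'.fg hfg (rightDual_fg hfP hΛ.isOrder.fg)
      (fun y hy => (hP y hy).1) hMe hΛP (rightDual_mul_le hΛ.isOrder.mul_le) hMP) le_sup_left
  have hPΛ' (y : A) (hy : y ∈ P) (x : A) (hx : x ∈ Λ') : y * x ∈ leftDual f Λ (rightDual f Λ P) :=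
    ⟨by rw [mul_assoc, ((mem_corner_iff_of_isIdempotentElem hf).1 (hΛ'.le_corner x hx)).2],
      fun m hm => (le_sup_right.trans hsup.le)
        (Submodule.mul_mem_mul (Submodule.mul_mem_mul hy hx) hm)⟩
  exact fun x hx => ⟨hΛ'.le_corner x hx, fun y hy => hrefl ▸ hPΛ' y hy x hx⟩

theorem span_map_mulRight (hc : Commute e u)
    (hspan : Submodule.span ℚ (Λ : Set A) = corner e) :
    Submodule.span ℚ (Λ.map (LinearMap.mulRight R u) : Set A) = peirce e (u * e) := by
  have himage : (Λ.map (LinearMap.mulRight R u) : Set A) = LinearMap.mulRight ℚ u '' Λ := rfl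
  rw [himage, ← Submodule.map_span, hspan, corner, peirce, ← LinearMap.range_comp]
  congr 1
  ext x
  simp [mul_assoc, hc.eq]

theorem mem_rightOrder_map_mulRight_iff (hc : Commute e u) (he : IsIdempotentElem e)
    (hu : IsIdempotentElem u) (hΛ : IsOrder R e Λ) :
    x ∈ rightOrder (u * e) (Λ.map (LinearMap.mulRight R u)) ↔
      x ∈ Λ.map (LinearMap.mulRight R u) ∧ u * x = x := by
  have hf : IsIdempotentElem (u * e) := hu.mul_of_commute hc.symm he
  have hΛe (a : A) (ha : a ∈ Λ) : e * a = a ∧ a * e = a :=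
    (mem_corner_iff_of_isIdempotentElem he).1 (hΛ.le_corner a ha)
  constructor
  · rintro ⟨hx, hPx⟩
    have hfx := ((mem_corner_iff_of_isIdempotentElem hf).1 hx).1
    refine ⟨?_, by rw [← hfx, mul_assoc, hu.mul_self_mul]⟩
    rw [← hfx, ← hc.eq]
    exact hPx _ ⟨e, hΛ.one_mem, rfl⟩
  · rintro ⟨⟨a, ha, rfl⟩, hux⟩
    simp only [LinearMap.mulRight_apply] at hux ⊢
    refine ⟨(mem_corner_iff_of_isIdempotentElem hf).2 ⟨?_, ?_⟩, ?_⟩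
    · rw [mul_assoc, ← mul_assoc e, (hΛe a ha).1, hux]
    · rw [mul_assoc, hu.mul_self_mul, ← hc.eq, ← mul_assoc, (hΛe a ha).2]
    · rintro _ ⟨b, hb, rfl⟩
      exact ⟨b * a, hΛ.mul_mem b hb a ha, by simp [mul_assoc, hux]⟩

theorem leftDual_rightDual_map_mulRight (hc : Commute e u) (he : IsIdempotentElem e)
    (hu : IsIdempotentElem u) (hΛ : IsOrder R e Λ) {n : ℕ} (hn : n ≠ 0)
    (hmul : ∀ a ∈ Λ, a * ((n : ℚ) • u) ∈ Λ)
    (hfix : ∀ a ∈ Λ, a * u = a → ∃ w ∈ Λ, w * ((n : ℚ) • u) = a) :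
    leftDual (u * e) Λ (rightDual (u * e) Λ (Λ.map (LinearMap.mulRight R u))) =
      Λ.map (LinearMap.mulRight R u) := by
  have hf : IsIdempotentElem (u * e) := hu.mul_of_commute hc.symm he
  have hΛe (a : A) (ha : a ∈ Λ) : a * e = a :=
    ((mem_corner_iff_of_isIdempotentElem he).1 (hΛ.le_corner a ha)).2
  refine le_antisymm (fun x hx => ?_) ?_
  · have hnf : (n : ℚ) • (u * e) ∈ rightDual (u * e) Λ (Λ.map (LinearMap.mulRight R u)) := by
      refine ⟨by rw [mul_smul_comm, hf.eq], ?_⟩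
      rintro _ ⟨a, ha, rfl⟩
      have hau : a * u * ((n : ℚ) • (u * e)) = a * ((n : ℚ) • u) * e := by
        simp only [mul_smul_comm, smul_mul_assoc, mul_assoc, hu.mul_self_mul]
      rw [LinearMap.mulRight_apply, hau, hΛe _ (hmul a ha)]
      exact hmul a ha
    have hnx : (n : ℚ) • x ∈ Λ := by
      have hxnf := hx.2 _ hnf
      rwa [mul_smul_comm, hx.1] at hxnf
    have hxu : x * u = x := by rw [← hx.1, ← hc.eq, mul_assoc, mul_assoc, hu]
    obtain ⟨w, hw, hwu⟩ := hfix _ hnx (by rw [smul_mul_assoc, hxu])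
    rw [mul_smul_comm] at hwu
    exact ⟨w, hw, smul_right_injective A (Nat.cast_ne_zero.2 hn : (n : ℚ) ≠ 0) hwu⟩
  · rintro _ ⟨a, ha, rfl⟩
    refine ⟨?_, fun m hm => hm.2 _ ⟨a, ha, rfl⟩⟩
    rw [LinearMap.mulRight_apply, mul_assoc, hu.mul_self_mul, ← hc.eq, ← mul_assoc, hΛe a ha]

end Orders

section GroupRing

variable {Γ : Type*} [Group Γ] {S : Set Nat.Primes} {e : ℚ[Γ]}

theorem groupRing_eq_span :
    groupRing S Γ = Submodule.span (ZS S) (Set.range (MonoidAlgebra.of ℚ Γ)) := by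
  refine le_antisymm (fun x hx => ?_) (Submodule.span_le.2 ?_)
  · rw [← MonoidAlgebra.sum_coeff_single x]
    refine Submodule.sum_mem _ fun g _ => ?_
    have hsingle : MonoidAlgebra.single g (x.coeff g) =
        (⟨x.coeff g, hx g⟩ : ZS S) • MonoidAlgebra.of ℚ Γ g := by
      simp [Subring.smul_def]
    exact hsingle ▸ Submodule.smul_mem _ _ (Submodule.subset_span ⟨g, rfl⟩)
  · classical
    rintro _ ⟨g, rfl⟩ h
    rw [MonoidAlgebra.of_apply, MonoidAlgebra.coeff_single, Finsupp.single_apply]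
    split_ifs
    exacts [one_mem _, zero_mem _]

theorem of_mem_groupRing (g : Γ) : MonoidAlgebra.of ℚ Γ g ∈ groupRing S Γ :=
  (groupRing_eq_span (S := S)).ge (Submodule.subset_span ⟨g, rfl⟩)

theorem mem_groupRing_of_forall_isGoodPrime (hS : ∀ p ∈ S, IsGoodPrime p e) : e ∈ groupRing S Γ :=
  fun g p hp => (hS p hp).1 g p rfl

variable [Finite Γ]

theorem isOrder_groupRing : IsOrder (ZS S) (1 : ℚ[Γ]) (groupRing S Γ) where
  le_corner x _ := corner_one (A := ℚ[Γ]) ▸ Submodule.mem_top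
  one_mem := by
    rw [← map_one (MonoidAlgebra.of ℚ Γ)]
    exact of_mem_groupRing 1
  mul_mem x hx y hy := by
    have hxy := Submodule.mul_mem_mul hx hy
    rw [groupRing_eq_span, Submodule.span_mul_span] at hxy
    rw [groupRing_eq_span]
    refine Submodule.span_mono (Set.mul_subset_iff.2 ?_) hxy
    rintro _ ⟨g, rfl⟩ _ ⟨h, rfl⟩
    exact ⟨g * h, map_mul _ _ _⟩
  fg := by
    rw [groupRing_eq_span]
    exact Submodule.fg_span (Set.finite_range _)
  span_eq := by
    rw [groupRing_eq_span, Submodule.span_span_of_tower, corner_one, eq_top_iff]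
    intro x _
    rw [← MonoidAlgebra.sum_coeff_single x]
    refine Submodule.sum_mem _ fun g _ => ?_
    rw [← mul_one (x.coeff g), ← smul_eq_mul, ← MonoidAlgebra.smul_single]
    exact Submodule.smul_mem _ _ (Submodule.subset_span ⟨g, rfl⟩)

theorem isMaximalOrder_map_mulLeft_groupRing (hc : ∀ x, e * x = x * e)
    (he : IsIdempotentElem e) (hS : ∀ p ∈ S, IsGoodPrime p e) :
    IsMaximalOrder (ZS S) e ((groupRing S Γ).map (LinearMap.mulLeft (ZS S) e)) where
  isOrder := IsOrder.map_mulLeft isOrder_groupRing hc he (mem_groupRing_of_forall_isGoodPrime hS)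
  maximal Λ hΛ hle := by
    refine le_antisymm (fun x hx => ⟨x, fun g p hp => ?_, ?_⟩) hle
    · obtain ⟨hep, hmax⟩ := hS p hp
      have hspan := hmax.maximal _ (hΛ.span (ZS_anti (Set.singleton_subset_iff.2 hp))) (by
        rw [groupRing_eq_span, Submodule.map_span_le]
        rintro _ ⟨g, rfl⟩
        exact Submodule.subset_span (hle ⟨_, of_mem_groupRing g, rfl⟩))
      obtain ⟨y, hy, rfl⟩ : x ∈ (groupRing {p} Γ).map (LinearMap.mulLeft (ZS {p}) e) :=
        hspan ▸ Submodule.subset_span hx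
      exact isOrder_groupRing.mul_mem e hep y hy g p rfl
    · exact ((mem_corner_iff_of_isIdempotentElem he).1 (hΛ.le_corner x hx)).1

end GroupRing

section UnitIdem

variable {Γ : Type*} [Group Γ] [Finite Γ] {S : Set Nat.Primes} {Γ' : Subgroup Γ} {x : ℚ[Γ]}

theorem card_smul_unitIdem (Γ' : Subgroup Γ) :
    (Nat.card Γ' : ℚ) • unitIdem Γ' = ∑ᶠ τ : Γ', MonoidAlgebra.of ℚ Γ (τ : Γ) := by
  rw [unitIdem, smul_inv_smul₀ (Nat.cast_ne_zero.2 Nat.card_pos.ne')]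

theorem card_smul_unitIdem_mem_groupRing (Γ' : Subgroup Γ) :
    (Nat.card Γ' : ℚ) • unitIdem Γ' ∈ groupRing S Γ :=
  card_smul_unitIdem Γ' ▸ finsum_induction (· ∈ groupRing S Γ) (zero_mem _)
    (fun _ _ => add_mem) fun τ => of_mem_groupRing (τ : Γ)

theorem of_mul_unitIdem {τ : Γ} (hτ : τ ∈ Γ') :
    MonoidAlgebra.of ℚ Γ τ * unitIdem Γ' = unitIdem Γ' := by
  have := Fintype.ofFinite Γ'
  rw [unitIdem, mul_smul_comm, finsum_eq_sum_of_fintype, Finset.mul_sum]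
  congr 1
  exact Fintype.sum_equiv (Equiv.mulLeft ⟨τ, hτ⟩) _ _ fun σ => by simp

theorem unitIdem_mul_of {τ : Γ} (hτ : τ ∈ Γ') :
    unitIdem Γ' * MonoidAlgebra.of ℚ Γ τ = unitIdem Γ' := by
  have := Fintype.ofFinite Γ'
  rw [unitIdem, smul_mul_assoc, finsum_eq_sum_of_fintype, Finset.sum_mul]
  congr 1
  exact Fintype.sum_equiv (Equiv.mulRight ⟨τ, hτ⟩) _ _ fun σ => by simp

theorem forall_of_mul_eq_iff_unitIdem_mul_eq :
    (∀ τ ∈ Γ', MonoidAlgebra.of ℚ Γ τ * x = x) ↔ unitIdem Γ' * x = x := by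
  refine ⟨fun hx => ?_, fun hx τ hτ => by rw [← hx, ← mul_assoc, of_mul_unitIdem hτ]⟩
  have := Fintype.ofFinite Γ'
  rw [unitIdem, smul_mul_assoc, finsum_eq_sum_of_fintype, Finset.sum_mul,
    Finset.sum_congr rfl fun (τ : Γ') _ => hx τ τ.2, Finset.sum_const, Finset.card_univ,
    ← Nat.card_eq_fintype_card, ← Nat.cast_smul_eq_nsmul ℚ,
    inv_smul_smul₀ (Nat.cast_ne_zero.2 Nat.card_pos.ne')]

theorem isIdempotentElem_unitIdem : IsIdempotentElem (unitIdem Γ') :=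
  forall_of_mul_eq_iff_unitIdem_mul_eq.1 fun _ => of_mul_unitIdem

theorem coeff_mul_of_mem_of_mul_unitIdem_eq (hx : x * unitIdem Γ' = x) (g : Γ) {τ : Γ}
    (hτ : τ ∈ Γ') : x.coeff (g * τ) = x.coeff g := by
  have hxτ : x * MonoidAlgebra.of ℚ Γ τ = x := by rw [← hx, mul_assoc, unitIdem_mul_of hτ]
  conv_lhs => rw [← hxτ]
  simp [MonoidAlgebra.of_apply]

theorem exists_mul_card_smul_unitIdem_eq (hx : x ∈ groupRing S Γ) (hxu : x * unitIdem Γ' = x) :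
    ∃ w ∈ groupRing S Γ, w * ((Nat.card Γ' : ℚ) • unitIdem Γ') = x := by
  classical
  have := Fintype.ofFinite Γ'
  let IsRep (g : Γ) : Prop := (g : Γ ⧸ Γ').out = g
  -- `w` keeps the coefficients of `x` at one representative of each coset of `Γ'`.
  let w : ℚ[Γ] := .ofCoeff (x.coeff.filter IsRep)
  have hw (g : Γ) : w.coeff g = if IsRep g then x.coeff g else 0 := Finsupp.filter_apply _ _ g
  refine ⟨w, fun g => ?_, ?_⟩
  · rw [hw]
    split_ifs
    exacts [hx g, zero_mem _]
  · ext g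
    have hmem : (g : Γ ⧸ Γ').out⁻¹ * g ∈ Γ' := QuotientGroup.eq.1 (QuotientGroup.out_eq' _)
    have hrep (τ : Γ') : IsRep (g * (τ : Γ)⁻¹) ↔ τ = ⟨_, hmem⟩ := by
      simp only [IsRep, QuotientGroup.mk_mul_of_mem g (inv_mem τ.2), Subtype.ext_iff,
        eq_mul_inv_iff_mul_eq, eq_inv_mul_iff_mul_eq]
    rw [card_smul_unitIdem, finsum_eq_sum_of_fintype, Finset.mul_sum, MonoidAlgebra.coeff_sum,
      Finsupp.finsetSum_apply]
    simp only [MonoidAlgebra.of_apply, MonoidAlgebra.coeff_mul_single_apply, mul_one, hw, hrep,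
      coeff_mul_of_mem_of_mul_unitIdem_eq hxu g (inv_mem (Subtype.property _)),
      Finset.sum_ite_eq', Finset.mem_univ, if_true]

theorem mul_card_smul_unitIdem_mem_map_mulLeft {e : ℚ[Γ]}
    (hx : x ∈ (groupRing S Γ).map (LinearMap.mulLeft (ZS S) e)) :
    x * ((Nat.card Γ' : ℚ) • unitIdem Γ') ∈
      (groupRing S Γ).map (LinearMap.mulLeft (ZS S) e) := by
  obtain ⟨g, hg, rfl⟩ := hx
  exact ⟨_, isOrder_groupRing.mul_mem g hg _ (card_smul_unitIdem_mem_groupRing Γ'),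
    (mul_assoc _ _ _).symm⟩

theorem exists_mem_map_mulLeft_mul_card_smul_unitIdem_eq {e : ℚ[Γ]} (he : IsIdempotentElem e)
    (heG : e ∈ groupRing S Γ) (hx : x ∈ (groupRing S Γ).map (LinearMap.mulLeft (ZS S) e))
    (hxu : x * unitIdem Γ' = x) :
    ∃ w ∈ (groupRing S Γ).map (LinearMap.mulLeft (ZS S) e),
      w * ((Nat.card Γ' : ℚ) • unitIdem Γ') = x := by
  obtain ⟨g, hg, rfl⟩ := hx
  obtain ⟨w, hw, hwx⟩ :=
    exists_mul_card_smul_unitIdem_eq (isOrder_groupRing.mul_mem e heG g hg) hxu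
  exact ⟨e * w, ⟨w, hw, rfl⟩, by rw [mul_assoc, hwx, LinearMap.mulLeft_apply, he.mul_self_mul]⟩

theorem leftInvariants_map_mulRight_unitIdem {R : Subring ℚ} {e : ℚ[Γ]}
    (hc : Commute e (unitIdem Γ')) (he : IsIdempotentElem e) {Λ : Submodule R ℚ[Γ]}
    (hΛ : IsOrder R e Λ) :
    leftInvariants Γ' (Λ.map (LinearMap.mulRight R (unitIdem Γ'))) =
      rightOrder (unitIdem Γ' * e) (Λ.map (LinearMap.mulRight R (unitIdem Γ'))) := by
  ext x
  rw [mem_rightOrder_map_mulRight_iff hc he isIdempotentElem_unitIdem hΛ]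
  exact and_congr_right' forall_of_mul_eq_iff_unitIdem_mul_eq

end UnitIdem

end HeckeOrder

open HeckeOrder in
theorem mainTheorem9_general {Γ : Type*} [Group Γ] [Finite Γ] (Γ' : Subgroup Γ)
    (S : Set Nat.Primes) {e : ℚ[Γ]} (hc : ∀ x, e * x = x * e) (he : IsIdempotentElem e)
    (hS : ∀ p ∈ S, IsGoodPrime p e) {O : Submodule (ZS S) ℚ[Γ]} (hO : IsOrder (ZS S) 1 O)
    (hΓO : groupRing S Γ ≤ O) :
    IsMaximalOrder (ZS S) (unitIdem Γ' * e) (leftInvariants Γ'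
      (O.map (LinearMap.mulLeft (ZS S) e ∘ₗ LinearMap.mulRight (ZS S) (unitIdem Γ')))) := by
  let Λ := (groupRing S Γ).map (LinearMap.mulLeft (ZS S) e)
  have heG : e ∈ groupRing S Γ := mem_groupRing_of_forall_isGoodPrime hS
  have hΛ : IsMaximalOrder (ZS S) e Λ := isMaximalOrder_map_mulLeft_groupRing hc he hS
  have heO : O.map (LinearMap.mulLeft (ZS S) e) = Λ :=
    hΛ.maximal _ (hO.map_mulLeft hc he (hΓO heG)) (Submodule.map_mono hΓO)
  have hu : IsIdempotentElem (unitIdem Γ') := isIdempotentElem_unitIdem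
  have hrefl := leftDual_rightDual_map_mulRight (hc _) he hu hΛ.isOrder Nat.card_pos.ne'
    (fun _ => mul_card_smul_unitIdem_mem_map_mulLeft)
    (fun _ => exists_mem_map_mulLeft_mul_card_smul_unitIdem_eq (Γ' := Γ') he heG)
  have hcomm : LinearMap.mulLeft (ZS S) e ∘ₗ LinearMap.mulRight (ZS S) (unitIdem Γ') =
      LinearMap.mulRight (ZS S) (unitIdem Γ') ∘ₗ LinearMap.mulLeft (ZS S) e :=
    (LinearMap.commute_mulLeft_right e (unitIdem Γ')).eq
  rw [hcomm, Submodule.map_comp, heO, leftInvariants_map_mulRight_unitIdem (hc _) he hΛ.isOrder]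
  exact isMaximalOrder_rightOrder hΛ he (hu.mul_of_commute (hc _).symm he)
    (by rw [← hc, he.mul_self_mul]) (hΛ.isOrder.fg.map _)
    (span_map_mulRight (hc _) hΛ.isOrder.span_eq) hrefl

theorem mainTheorem9 {Γ : Type*} [Group Γ] [Finite Γ] (Γ' : Subgroup Γ) (S : Set Nat.Primes)
    (hS : ∀ p ∈ S, HeckeOrder.IsGoodPrime p (HeckeOrder.augIdem Γ'))
    (O : Submodule (HeckeOrder.ZS S) ℚ[Γ])
    (hO : HeckeOrder.IsMaximalOrder (HeckeOrder.ZS S) (1 : ℚ[Γ]) O)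
    (hΓO : HeckeOrder.groupRing S Γ ≤ O) :
    HeckeOrder.IsMaximalOrder (HeckeOrder.ZS S)
      (HeckeOrder.unitIdem Γ' * HeckeOrder.augIdem Γ') (HeckeOrder.heckeOrder Γ' O) :=
  mainTheorem9_general Γ' S (HeckeOrder.augIdem_spec Γ').central (HeckeOrder.augIdem_spec Γ').idem
    hS hO.isOrder hΓO
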